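/- Let $n\ge 0$, let $M_n$ be the space of complex $n\times n$ matrices, and let $P^d(M_n)$ be the space of homogeneous polynomials of degree $d$ in the entries of $Q\in M_n$. Regard $S_n$ as the group of permutation matrices in $\mathrm{GL}_n(\mathbf C)$. For a finite-dimensional complex representation $(\rho,V)$ of $S_n$ and $d\ge 0$, put $$\mathrm{Ind}^d V=\{f\in P^d(M_n)\otimes V \mid f(wQ)=\rho(w)f(Q)\text{ for all }w\in S_n,\ Q\in M_n\},$$ a homogeneous polynomial representation of $\mathrm{GL}_n(\mathbf C)$ of degree $d$ under the action $(g\cdot f)(Q)=f(Qg)$. Let $\mathrm{ch}\,\mathrm{Ind}^d V$ be its character, the symmetric polynomial in $t_1,\dotsc,t_n$ whose value is the trace of $\mathrm{diag}(t_1,\dotsc,t_n)$ on $\mathrm{Ind}^d V$, and let $\mathrm{ch}\,\mathrm{Ind}\,V=\sum_{d\ge 0}\mathrm{ch}\,\mathrm{Ind}^d V$, a symmetric formal power series in $t_1,\dotsc,t_n$. Let $\mathcal F(V)=\frac1{n!}\sum_{w\in S_n}\mathrm{trace}(\rho(w);V)\,p_{\lambda(w)}$ be the Frobenius characteristic of $V$,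 a symmetric function in infinitely many variables; here $\lambda(w)$ is the cycle type of $w$, $p_\lambda=p_{\lambda_1}p_{\lambda_2}\dotsm$ and $p_k=\sum_i x_i^k$. Let $$H=H(t_1,\dotsc,t_n)=\sum_{k\ge 0}h_k(t_1,\dotsc,t_n),$$ where $h_k$ is the $k$th complete symmetric polynomial. For a symmetric function $f$ and a sum $g=t^{\mathbf x_1}+t^{\mathbf x_2}+\dotsb$ of finitely or infinitely many monic monomials in $t_1,\dotsc,t_n$, each occurring finitely often, the plethysm $f[g]=f(t^{\mathbf x_1},t^{\mathbf x_2},\dotsc)$ is obtained by substituting these monomials for the variables of $f$ (the remaining variables, if any, being set to $0$). Then for every finite-dimensional complex representation $V$ of $S_n$, $$\mathrm{ch}\,\mathrm{Ind}\,V=\mathcal F(V)[H].$$ -/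

import Mathlib

open scoped TensorProduct

noncomputable section

namespace PolyInd

/-! ## Polynomial representations of `GL_n(ℂ)` and their characters -/

/-- A homogeneous polynomial representation of `GL_n(ℂ)` of degree `d`: a finite dimensional complex
representation all of whose matrix coefficients `g ↦ φ (ρ(g) u)` are given by homogeneous
polynomials of degree `d` in the entries of `g`. -/
structure PolyRep (n d : ℕ) where
  /-- the underlying vector space -/
  W : Type*
  [addCommGroup : AddCommGroup W]
  [module : Module ℂ W]
  [finiteDimensional : FiniteDimensional ℂ W]
  /-- the action of `GL_n(ℂ)` -/
  rep : Representation ℂ (Matrix.GeneralLinearGroup (Fin n) ℂ) W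
  isPolynomial : ∀ (φ : Module.Dual ℂ W) (u : W),
    ∃ p : MvPolynomial (Fin n × Fin n) ℂ, p.IsHomogeneous d ∧
      ∀ g : Matrix.GeneralLinearGroup (Fin n) ℂ,
        φ (rep g u) = MvPolynomial.eval (fun ij => g.1 ij.1 ij.2) p

attribute [instance] PolyRep.addCommGroup PolyRep.module PolyRep.finiteDimensional

/-- The diagonal matrix `diag(t_1, …, t_n)` as an element of `GL_n(ℂ)`. -/
def diagGL {n : ℕ} (t : Fin n → ℂˣ) : Matrix.GeneralLinearGroup (Fin n) ℂ where
  val := Matrix.diagonal fun i => (t i : ℂ)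
  inv := Matrix.diagonal fun i => ((t i)⁻¹ : ℂˣ)
  val_inv := by simp
  inv_val := by simp

/-- The trace of `diag(t_1, …, t_n)` on a homogeneous polynomial representation of degree `d` is a
homogeneous polynomial of degree `d` in `t_1, …, t_n`. -/
theorem PolyRep.exists_character {n d : ℕ} (σ : PolyRep n d) :
    ∃ P : MvPolynomial (Fin n) ℂ, P.IsHomogeneous d ∧
      ∀ t : Fin n → ℂˣ,
        MvPolynomial.eval (fun i => (t i : ℂ)) P = LinearMap.trace ℂ σ.W (σ.rep (diagGL t)) := by
  let b := Module.finBasis ℂ σ.W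
  choose p hp hpe using fun i => σ.isPolynomial (b.coord i) (b i)
  let s : Fin n × Fin n → MvPolynomial (Fin n) ℂ :=
    fun ij => if ij.1 = ij.2 then MvPolynomial.X ij.1 else 0
  refine ⟨∑ i, MvPolynomial.aeval s (p i), ?_, fun t => ?_⟩
  · refine MvPolynomial.IsHomogeneous.sum _ _ _ fun i _ => ?_
    have := (hp i).aeval s (n := 1) (fun ij => by
      dsimp only [s]
      split_ifs
      · exact MvPolynomial.isHomogeneous_X _ _
      · exact MvPolynomial.isHomogeneous_zero _ _ _)
    simpa using this
  · rw [LinearMap.trace_eq_matrix_trace ℂ b, Matrix.trace, map_sum]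
    refine Finset.sum_congr rfl fun i _ => ?_
    have h := hpe i (diagGL t)
    rw [Matrix.diag_apply, LinearMap.toMatrix_apply]
    rw [Module.Basis.coord_apply] at h
    rw [h, MvPolynomial.map_aeval, MvPolynomial.eval]
    congr 2
    · ext; simp
    · funext ij
      dsimp only [s, diagGL]
      rw [Matrix.diagonal_apply]
      split_ifs <;> simp

/-- The character `ch ρ(t_1, …, t_n) = trace(ρ(diag(t_1, …, t_n)))` of a homogeneous polynomial
representation, as a polynomial in `t_1, …, t_n`. -/
def PolyRep.ch {n d : ℕ} (σ : PolyRep n d) : MvPolynomial (Fin n) ℂ :=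
  Classical.choose σ.exists_character

/-- `σ.ch` is characterized by this equation, since a polynomial is determined by its values
at points with nonzero coordinates. -/
theorem PolyRep.eval_ch {n d : ℕ} (σ : PolyRep n d) (t : Fin n → ℂˣ) :
    MvPolynomial.eval (fun i => (t i : ℂ)) σ.ch = LinearMap.trace ℂ σ.W (σ.rep (diagGL t)) :=
  (Classical.choose_spec σ.exists_character).2 t

/-- By homogeneity, in each degree only one summand contributes to `∑_d ch σ_d`. -/
theorem PolyRep.isHomogeneous_ch {n d : ℕ} (σ : PolyRep n d) : σ.ch.IsHomogeneous d :=
  (Classical.choose_spec σ.exists_character).1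

/-- The character of a polynomial representation is a symmetric polynomial. -/
theorem PolyRep.isSymmetric_ch {n d : ℕ} (σ : PolyRep n d) : σ.ch.IsSymmetric := by
  intro e
  refine MvPolynomial.funext_set (fun _ => {0}ᶜ) (fun _ => (Set.finite_singleton 0).infinite_compl)
    fun x hx => ?_
  let t : Fin n → ℂˣ := fun i => Units.mk0 (x i) (hx i trivial)
  have hP : (e.permMatrix ℂ) * (e⁻¹).permMatrix ℂ = 1 := by
    rw [← Matrix.permMatrix_mul]; simp
  let P : Matrix.GeneralLinearGroup (Fin n) ℂ :=
    ⟨e.permMatrix ℂ, (e⁻¹).permMatrix ℂ, hP, mul_eq_one_comm.mp hP⟩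
  have hd : diagGL (fun i => t (e i)) = P * diagGL t * P⁻¹ := by
    rw [eq_mul_inv_iff_mul_eq]
    ext i j
    simp [P, diagGL, Matrix.diagonal_mul, Matrix.mul_diagonal, PEquiv.toMatrix_apply]
    split_ifs with h
    · rw [h]
    · rfl
  have h1 := σ.eval_ch t
  have h2 := σ.eval_ch fun i => t (e i)
  rw [hd, σ.rep.map_mul, LinearMap.trace_mul_comm, ← σ.rep.map_mul, ← mul_assoc, inv_mul_cancel,
    one_mul] at h2
  rw [MvPolynomial.eval_rename]
  exact h2.trans h1.symm

/-- The character of a family `{σ_d}_{d ≥ 0}` of homogeneous polynomial representations of degrees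
`d = 0, 1, 2, …`: the formal power series `∑_{d ≥ 0} ch σ_d`. -/
def chFamily {n : ℕ} (σ : (d : ℕ) → PolyRep n d) : MvPowerSeries (Fin n) ℂ :=
  fun x => ∑ᶠ d : ℕ, (σ d).ch.coeff x

/-! ## Polynomial induction -/

/-- `P^d(M_n)`, the space of homogeneous polynomials of degree `d` in the entries `q_{ij}` of an
`n × n` matrix. -/
def HomPoly (n d : ℕ) : Type := MvPolynomial.homogeneousSubmodule (Fin n × Fin n) ℂ d

instance (n d : ℕ) : AddCommGroup (HomPoly n d) :=
  inferInstanceAs (AddCommGroup (MvPolynomial.homogeneousSubmodule (Fin n × Fin n) ℂ d))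

instance (n d : ℕ) : Module ℂ (HomPoly n d) :=
  inferInstanceAs (Module ℂ (MvPolynomial.homogeneousSubmodule (Fin n × Fin n) ℂ d))

instance (n d : ℕ) : FiniteDimensional ℂ (HomPoly n d) :=
  Module.Finite.iff_fg.mpr (MvPolynomial.homogeneousSubmodule_fg (Fin n × Fin n) ℂ d)

/-- The inclusion of `P^d(M_n)` into the ring of all polynomials in the entries. -/
def HomPoly.incl (n d : ℕ) : HomPoly n d →ₗ[ℂ] MvPolynomial (Fin n × Fin n) ℂ :=
  (MvPolynomial.homogeneousSubmodule (Fin n × Fin n) ℂ d).subtype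

theorem HomPoly.isHomogeneous {n d : ℕ} (p : HomPoly n d) : (incl n d p).IsHomogeneous d := p.2

theorem HomPoly.incl_injective (n d : ℕ) : Function.Injective (incl n d) := Subtype.val_injective

/-- The substitution `p(Q) ↦ p(Q g)` on polynomials in the entries of `Q`. -/
def translate {n : ℕ} (g : Matrix (Fin n) (Fin n) ℂ) :
    MvPolynomial (Fin n × Fin n) ℂ →ₐ[ℂ] MvPolynomial (Fin n × Fin n) ℂ :=
  MvPolynomial.aeval fun ij => ∑ k, MvPolynomial.X (ij.1, k) * MvPolynomial.C (g k ij.2)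

theorem translate_isHomogeneous {n d : ℕ} (g : Matrix (Fin n) (Fin n) ℂ)
    {p : MvPolynomial (Fin n × Fin n) ℂ} (hp : p.IsHomogeneous d) :
    (translate g p).IsHomogeneous d := by
  have := MvPolynomial.IsHomogeneous.aeval (n := 1) hp
    (fun ij : Fin n × Fin n => ∑ k, (MvPolynomial.X (ij.1, k) * MvPolynomial.C (g k ij.2) :
      MvPolynomial (Fin n × Fin n) ℂ)) (fun ij => MvPolynomial.IsHomogeneous.sum _ _ _ fun k _ => by
        rw [mul_comm]; exact MvPolynomial.isHomogeneous_C_mul_X _ _)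
  simpa [translate] using this

theorem translate_one (n : ℕ) : translate (1 : Matrix (Fin n) (Fin n) ℂ) = AlgHom.id ℂ _ := by
  ext1 ij
  simp [translate, Matrix.one_apply, apply_ite]

theorem translate_mul {n : ℕ} (g h : Matrix (Fin n) (Fin n) ℂ) :
    translate (g * h) = (translate g).comp (translate h) := by
  ext1 ij
  simp only [translate, MvPolynomial.aeval_X, AlgHom.comp_apply, map_sum, map_mul, 
    MvPolynomial.algHom_C, Matrix.mul_apply, Finset.mul_sum, Finset.sum_mul]
  rw [Finset.sum_comm]
  simp [mul_assoc]

/-- The substitution `p(Q) ↦ p(Q g)` on `P^d(M_n)`. -/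
def translateHom {n : ℕ} (d : ℕ) (g : Matrix (Fin n) (Fin n) ℂ) : HomPoly n d →ₗ[ℂ] HomPoly n d :=
  ((translate g).toLinearMap ∘ₗ HomPoly.incl n d).codRestrict
    (MvPolynomial.homogeneousSubmodule (Fin n × Fin n) ℂ d)
    fun p => translate_isHomogeneous g p.isHomogeneous

theorem incl_translateHom {n d : ℕ} (g : Matrix (Fin n) (Fin n) ℂ) (p : HomPoly n d) :
    HomPoly.incl n d (translateHom d g p) = translate g (HomPoly.incl n d p) := rfl

section Ind

variable {n : ℕ} {V : Type*} [AddCommGroup V] [Module ℂ V]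

/-- An element of `P^d(M_n) ⊗ V` is a `V`-valued polynomial `f` on `M_n`; this is its value
`f(Q)`, so that `(p ⊗ v)(Q) = p(Q) v`. -/
def evalAt (d : ℕ) (Q : Matrix (Fin n) (Fin n) ℂ) : HomPoly n d ⊗[ℂ] V →ₗ[ℂ] V :=
  (TensorProduct.lid ℂ V).toLinearMap ∘ₗ
    ((MvPolynomial.aeval fun ij => Q ij.1 ij.2).toLinearMap ∘ₗ HomPoly.incl n d).rTensor V

/-- The permutation matrix of `w`, which sends the basis vector `e_j` to `e_{w(j)}`; with this
convention `w ↦ permMat w` is a homomorphism, whereas `Equiv.Perm.permMatrix` is an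
antihomomorphism. -/
def permMat (w : Equiv.Perm (Fin n)) : Matrix (Fin n) (Fin n) ℂ := (w⁻¹).permMatrix ℂ

/-- The space `Ind^d V` of all `f ∈ P^d(M_n) ⊗ V` with `f(wQ) = ρ(w) f(Q)` for all `w ∈ S_n` and
`Q ∈ M_n`. -/
def indSpace (d : ℕ) (ρ : Representation ℂ (Equiv.Perm (Fin n)) V) :
    Submodule ℂ (HomPoly n d ⊗[ℂ] V) where
  carrier := {f | ∀ (w : Equiv.Perm (Fin n)) (Q : Matrix (Fin n) (Fin n) ℂ),
    evalAt d (permMat w * Q) f = ρ w (evalAt d Q f)}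
  zero_mem' := by simp
  add_mem' := fun hf hg w Q => by simp [hf w Q, hg w Q]
  smul_mem' := fun c f hf w Q => by simp [hf w Q]

theorem evalAt_translate (d : ℕ) (g Q : Matrix (Fin n) (Fin n) ℂ) (f : HomPoly n d ⊗[ℂ] V) :
    evalAt d Q ((translateHom d g).rTensor V f) = evalAt d (Q * g) f := by
  induction f with
  | zero => simp
  | add f₁ f₂ h₁ h₂ => simp only [map_add, h₁, h₂]
  | tmul p v =>
    have : (MvPolynomial.aeval fun ij => Q ij.1 ij.2).comp (translate g) =
        (MvPolynomial.aeval fun ij => (Q * g) ij.1 ij.2 : MvPolynomial (Fin n × Fin n) ℂ →ₐ[ℂ] ℂ) := by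
      ext ij
      simp [translate, Matrix.mul_apply]
    have h := DFunLike.congr_fun this (HomPoly.incl n d p)
    simp only [AlgHom.comp_apply] at h
    change (MvPolynomial.aeval fun ij => Q ij.1 ij.2) (translate g (HomPoly.incl n d p)) • v =
      (MvPolynomial.aeval fun ij => (Q * g) ij.1 ij.2) (HomPoly.incl n d p) • v
    rw [h]

/-- The action of `GL_n(ℂ)` on `Ind^d V`, given by `(g · f)(Q) = f(Qg)`. -/
def indRep (d : ℕ) (ρ : Representation ℂ (Equiv.Perm (Fin n)) V) :
    Representation ℂ (Matrix.GeneralLinearGroup (Fin n) ℂ) (indSpace d ρ) where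
  toFun g := ((translateHom d g.1).rTensor V).restrict fun f hf w Q => by
    rw [evalAt_translate, evalAt_translate, Matrix.mul_assoc, hf]
  map_one' := by
    ext1 f
    apply Subtype.ext
    have : translateHom d (1 : Matrix (Fin n) (Fin n) ℂ) = LinearMap.id := by
      ext1 p
      apply HomPoly.incl_injective
      rw [incl_translateHom, translate_one]
      rfl
    simp [LinearMap.restrict_apply, this]
  map_mul' g h := by
    ext1 f
    apply Subtype.ext
    have : translateHom d (g.1 * h.1) = translateHom d g.1 ∘ₗ translateHom d h.1 := by
      ext1 p
      apply HomPoly.incl_injective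
      rw [incl_translateHom, translate_mul]
      rfl
    change (translateHom d (g.1 * h.1)).rTensor V f.1 =
      (translateHom d g.1).rTensor V ((translateHom d h.1).rTensor V f.1)
    rw [this, LinearMap.rTensor_comp]
    rfl

/-- The generic translate `p(Q g)`, as a polynomial in `Q` whose coefficients are polynomials in
the entries of `g`. -/
def genericTranslate (n : ℕ) : MvPolynomial (Fin n × Fin n) ℂ →ₐ[ℂ]
    MvPolynomial (Fin n × Fin n) (MvPolynomial (Fin n × Fin n) ℂ) :=
  MvPolynomial.aeval fun ij =>
    ∑ k, MvPolynomial.X (ij.1, k) * MvPolynomial.C (MvPolynomial.X (k, ij.2))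

theorem map_genericTranslate (g : Matrix (Fin n) (Fin n) ℂ) (p : MvPolynomial (Fin n × Fin n) ℂ) :
    MvPolynomial.map (MvPolynomial.eval fun ij => g ij.1 ij.2) (genericTranslate n p) =
      translate g p := by
  induction p using MvPolynomial.induction_on with
  | C a => simp [genericTranslate, translate, MvPolynomial.algebraMap_apply]
  | add p q hp hq => simp only [map_add, hp, hq]
  | mul_X p i hp =>
    rw [map_mul, map_mul, map_mul, hp]
    simp [genericTranslate, translate]

theorem isHomogeneous_coeff_mul {τ τ' : Type*} {a b : ℕ}
    {P R : MvPolynomial τ (MvPolynomial τ' ℂ)} (hP : ∀ m, (P.coeff m).IsHomogeneous a)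
    (hR : ∀ m, (R.coeff m).IsHomogeneous b) (m : τ →₀ ℕ) :
    ((P * R).coeff m).IsHomogeneous (a + b) := by
  classical
  rw [MvPolynomial.coeff_mul]
  exact MvPolynomial.IsHomogeneous.sum _ _ _ fun x _ => (hP _).mul (hR _)

theorem isHomogeneous_coeff_genericTranslate (s : Fin n × Fin n →₀ ℕ) (r : ℂ)
    (m : Fin n × Fin n →₀ ℕ) :
    ((genericTranslate n (MvPolynomial.monomial s r)).coeff m).IsHomogeneous s.degree := by
  classical
  induction s using Finsupp.induction_linear generalizing r m with
  | zero =>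
    have : genericTranslate n (MvPolynomial.monomial 0 r) =
        MvPolynomial.C (MvPolynomial.C r) := by
      rw [genericTranslate, MvPolynomial.aeval_monomial]
      simp [MvPolynomial.algebraMap_apply]
    rw [this, MvPolynomial.coeff_C]
    split_ifs
    · simpa using MvPolynomial.isHomogeneous_C _ r
    · exact MvPolynomial.isHomogeneous_zero _ _ _
  | add s₁ s₂ h₁ h₂ =>
    have : MvPolynomial.monomial (s₁ + s₂) r =
        (MvPolynomial.monomial s₁ r * MvPolynomial.monomial s₂ 1 :
          MvPolynomial (Fin n × Fin n) ℂ) := by simp [MvPolynomial.monomial_mul]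
    rw [this, map_mul, map_add]
    exact isHomogeneous_coeff_mul (h₁ r) (h₂ 1) m
  | single i k =>
    rw [Finsupp.degree_single]
    induction k generalizing r m with
    | zero =>
      have : genericTranslate n (MvPolynomial.monomial (Finsupp.single i 0) r) =
          MvPolynomial.C (MvPolynomial.C r) := by
        rw [genericTranslate, MvPolynomial.aeval_monomial]
        simp [MvPolynomial.algebraMap_apply]
      rw [this, MvPolynomial.coeff_C]
      split_ifs
      · exact MvPolynomial.isHomogeneous_C _ r
      · exact MvPolynomial.isHomogeneous_zero _ _ _
    | succ k ih =>
      have : MvPolynomial.monomial (Finsupp.single i (k + 1)) r =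
          (MvPolynomial.monomial (Finsupp.single i k) r * MvPolynomial.X i :
            MvPolynomial (Fin n × Fin n) ℂ) := by
        simp [MvPolynomial.X, MvPolynomial.monomial_mul]
      rw [this, map_mul]
      refine isHomogeneous_coeff_mul (ih r) (fun m => ?_) m
      rw [genericTranslate, MvPolynomial.aeval_X, MvPolynomial.coeff_sum]
      refine MvPolynomial.IsHomogeneous.sum _ _ _ fun l _ => ?_
      rw [mul_comm, MvPolynomial.coeff_C_mul, MvPolynomial.coeff_X]
      split_ifs
      · simpa using MvPolynomial.isHomogeneous_X ℂ (l, i.2)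
      · simpa using MvPolynomial.isHomogeneous_zero _ _ _

theorem exists_poly_translate {d : ℕ} (ψ : Module.Dual ℂ (MvPolynomial (Fin n × Fin n) ℂ))
    {p : MvPolynomial (Fin n × Fin n) ℂ} (hp : p.IsHomogeneous d) :
    ∃ q : MvPolynomial (Fin n × Fin n) ℂ, q.IsHomogeneous d ∧
      ∀ g : Matrix (Fin n) (Fin n) ℂ,
        ψ (translate g p) = MvPolynomial.eval (fun ij => g ij.1 ij.2) q := by
  have hG : ∀ m, ((genericTranslate n p).coeff m).IsHomogeneous d := by
    intro m
    rw [p.as_sum, map_sum, MvPolynomial.coeff_sum]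
    refine MvPolynomial.IsHomogeneous.sum _ _ _ fun s hs => ?_
    have : s.degree = d := by
      by_contra h
      exact (MvPolynomial.mem_support_iff.mp hs) (MvPolynomial.IsHomogeneous.coeff_eq_zero hp h)
    exact this ▸ isHomogeneous_coeff_genericTranslate s _ m
  refine ⟨∑ m ∈ (genericTranslate n p).support,
    MvPolynomial.C (ψ (MvPolynomial.monomial m 1)) * (genericTranslate n p).coeff m, ?_, ?_⟩
  · exact MvPolynomial.IsHomogeneous.sum _ _ _ fun m _ => (hG m).C_mul _
  · intro g
    rw [← map_genericTranslate]
    conv_lhs => rw [(genericTranslate n p).as_sum]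
    simp only [map_sum, MvPolynomial.map_monomial, map_mul, MvPolynomial.eval_C]
    refine Finset.sum_congr rfl fun m _ => ?_
    rw [← mul_one (MvPolynomial.eval _ _), ← smul_eq_mul, ← MvPolynomial.smul_monomial, map_smul,
      smul_eq_mul, smul_eq_mul, mul_one, mul_comm]

theorem exists_poly_rTensor {d : ℕ} (φ : Module.Dual ℂ (HomPoly n d ⊗[ℂ] V))
    (f : HomPoly n d ⊗[ℂ] V) :
    ∃ q : MvPolynomial (Fin n × Fin n) ℂ, q.IsHomogeneous d ∧
      ∀ g : Matrix (Fin n) (Fin n) ℂ,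
        φ ((translateHom d g).rTensor V f) = MvPolynomial.eval (fun ij => g ij.1 ij.2) q := by
  induction f with
  | zero => exact ⟨0, MvPolynomial.isHomogeneous_zero _ _ _, by simp⟩
  | add f₁ f₂ h₁ h₂ =>
    obtain ⟨q₁, hq₁, h₁⟩ := h₁
    obtain ⟨q₂, hq₂, h₂⟩ := h₂
    exact ⟨q₁ + q₂, hq₁.add hq₂, fun g => by simp only [map_add, h₁, h₂]⟩
  | tmul p v =>
    obtain ⟨ψ, hψ⟩ := LinearMap.exists_extend
      (p := MvPolynomial.homogeneousSubmodule (Fin n × Fin n) ℂ d)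
      (φ ∘ₗ (TensorProduct.mk ℂ (HomPoly n d) V).flip v)
    obtain ⟨q, hq, h⟩ := exists_poly_translate ψ p.isHomogeneous
    refine ⟨q, hq, fun g => ?_⟩
    rw [← h g]
    exact (DFunLike.congr_fun hψ (translateHom d g p)).symm

/-- `Ind^d V` as a homogeneous polynomial representation of `GL_n(ℂ)` of degree `d`. -/
def Ind (d : ℕ) [FiniteDimensional ℂ V] (ρ : Representation ℂ (Equiv.Perm (Fin n)) V) :
    PolyRep n d where
  W := indSpace d ρ
  rep := indRep d ρ
  isPolynomial φ u := by
    obtain ⟨φ', hφ'⟩ := LinearMap.exists_extend φ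
    obtain ⟨q, hq, h⟩ := exists_poly_rTensor φ' u.1
    refine ⟨q, hq, fun g => ?_⟩
    rw [← h g.1, ← hφ']
    rfl

end Ind

/-! ## Symmetric functions and the Frobenius characteristic -/

/-- The ring of symmetric functions over `ℂ` in the variables `x_0, x_1, x_2, …`: the formal power
series of bounded degree that are invariant under all permutations of the variables. -/
def SymmFun : Subalgebra ℂ (MvPowerSeries ℕ ℂ) where
  carrier := {f | (∀ e : Equiv.Perm ℕ, MvPowerSeries.rename e f = f) ∧
    ∃ N : ℕ, ∀ α : ℕ →₀ ℕ, MvPowerSeries.coeff α f ≠ 0 → α.degree ≤ N}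
  mul_mem' := by
    rintro f g ⟨hf, N, hN⟩ ⟨hg, M, hM⟩
    refine ⟨fun e => by rw [map_mul, hf, hg], N + M, fun α hα => ?_⟩
    classical
    rw [MvPowerSeries.coeff_mul] at hα
    obtain ⟨x, hx, hne⟩ := Finset.exists_ne_zero_of_sum_ne_zero hα
    rw [← Finset.HasAntidiagonal.mem_antidiagonal.mp hx, map_add]
    exact add_le_add (hN _ (left_ne_zero_of_mul hne)) (hM _ (right_ne_zero_of_mul hne))
  add_mem' := by
    rintro f g ⟨hf, N, hN⟩ ⟨hg, M, hM⟩
    refine ⟨fun e => by rw [map_add, hf, hg], max N M, fun α hα => ?_⟩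
    by_cases h : MvPowerSeries.coeff α f = 0
    · have : MvPowerSeries.coeff α g ≠ 0 := by
        intro h'; exact hα (by rw [map_add, h, h', add_zero])
      exact (hM α this).trans (le_max_right _ _)
    · exact (hN α h).trans (le_max_left _ _)
  algebraMap_mem' r := by
    refine ⟨fun e => by rw [AlgHom.commutes], 0, fun α hα => ?_⟩
    classical
    rw [MvPowerSeries.algebraMap_apply, MvPowerSeries.coeff_C] at hα
    have : α = 0 := by by_contra h; simp [h] at hα
    simp [this]

theorem coeff_embDomain_rename (f : MvPowerSeries ℕ ℂ) (e : Equiv.Perm ℕ) (α : ℕ →₀ ℕ) :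
    MvPowerSeries.coeff (α.embDomain e.toEmbedding) (MvPowerSeries.rename e f) =
      MvPowerSeries.coeff α f :=
  MvPowerSeries.coeff_embDomain_rename e.toEmbedding f α

open Classical in
/-- The underlying power series of the power sum `p_k`. -/
def psumSeries (k : ℕ) : MvPowerSeries ℕ ℂ :=
  fun α => if ∃ i, α = Finsupp.single i k then 1 else 0

open Classical in
theorem coeff_psumSeries (k : ℕ) (α : ℕ →₀ ℕ) : MvPowerSeries.coeff α (psumSeries k) =
    if ∃ i, α = Finsupp.single i k then 1 else 0 := rfl

/-- The power sum symmetric function `p_k = ∑_i x_i^k`, for `k ≥ 1`. -/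
def psum (k : ℕ) : SymmFun :=
  ⟨psumSeries k, by
    refine ⟨fun e => ?_, k, fun α hα => ?_⟩
    · ext α
      obtain ⟨β, rfl⟩ : ∃ β : ℕ →₀ ℕ, β.embDomain e.toEmbedding = α :=
        ⟨α.mapDomain e.symm, by
          rw [Finsupp.embDomain_eq_mapDomain, ← Finsupp.mapDomain_comp]
          simp⟩
      rw [coeff_embDomain_rename, coeff_psumSeries, coeff_psumSeries]
      classical
      refine if_congr ⟨?_, ?_⟩ rfl rfl
      · rintro ⟨i, rfl⟩
        exact ⟨e i, by simp⟩
      · rintro ⟨i, hi⟩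
        refine ⟨e.symm i, Finsupp.embDomain_injective e.toEmbedding ?_⟩
        simp [hi]
    · rw [coeff_psumSeries] at hα
      have : ∃ i, α = Finsupp.single i k := by
        by_contra h
        exact hα (if_neg h)
      obtain ⟨i, rfl⟩ := this
      simp⟩

/-- The Frobenius characteristic
`𝓕(V) = (1/n!) ∑_{w ∈ S_n} χ_V(w) p_{λ(w)}`, where `λ(w)` is the cycle type of `w` (with fixed
points counted as parts `1`) and `p_λ = p_{λ_1} p_{λ_2} ⋯`. -/
def frobeniusChar {n : ℕ} {V : Type*} [AddCommGroup V] [Module ℂ V]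
    (ρ : Representation ℂ (Equiv.Perm (Fin n)) V) : SymmFun :=
  ((n.factorial : ℂ)⁻¹) • ∑ w : Equiv.Perm (Fin n),
    LinearMap.trace ℂ V (ρ w) • (w.partition.parts.map psum).prod

/-! ## Plethysm -/

/-- The monic monomials of which a power series `g` with coefficients in `ℕ` is the sum: each
monomial `t^x` occurs as often as the coefficient of `t^x` in `g` says. -/
abbrev Monomials {n : ℕ} (g : MvPowerSeries (Fin n) ℕ) : Type :=
  Σ x : Fin n →₀ ℕ, Fin (MvPowerSeries.coeff x g)

/-- The substitution of the monic monomials of `g` into the variables of `f`, in the order given by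
the injection `e` of the monomials into the indices of the variables; variables that receive no
monomial are set to `0`. In
`∑_α f_α ∏_m (t^{x_m})^{α_m}`, where `m` runs over the monomials of `g`, the coefficient of `t^y` is
the sum of the `f_α` with `∑_m α_m x_m = y`. -/
def substMonomials {n : ℕ} (f : SymmFun) (g : MvPowerSeries (Fin n) ℕ) (e : Monomials g ↪ ℕ) :
    MvPowerSeries (Fin n) ℂ := fun y =>
  ∑ᶠ (α : Monomials g →₀ ℕ) (_ : (α.sum fun m k => k • m.1) = y),
    MvPowerSeries.coeff (α.embDomain e) f.1

/-- Since `f` is symmetric, the order of the monomials does not matter. -/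
theorem substMonomials_congr {n : ℕ} (f : SymmFun) (g : MvPowerSeries (Fin n) ℕ)
    (e e' : Monomials g ↪ ℕ) : substMonomials f g e = substMonomials f g e' := by
  funext y
  refine finsum_congr fun α => finsum_congr fun _ => ?_
  obtain ⟨τ, hτ⟩ := Equiv.Perm.exists_extending_pair
    (fun m : α.support => e m) (fun m : α.support => e' m)
    (e.injective.comp Subtype.val_injective) (e'.injective.comp Subtype.val_injective)
  have h : (α.embDomain e).embDomain τ.toEmbedding = α.embDomain e' := by
    simp only [Finsupp.embDomain_eq_mapDomain, ← Finsupp.mapDomain_comp]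
    exact Finsupp.mapDomain_congr fun m hm => hτ ⟨m, hm⟩
  rw [← h]
  conv_rhs => rw [← f.2.1 τ, coeff_embDomain_rename]

/-- Since `f` has bounded degree, the sums in the definition of `substMonomials` are finite. -/
theorem substMonomials_finite {n : ℕ} (f : SymmFun) (g : MvPowerSeries (Fin n) ℕ)
    (e : Monomials g ↪ ℕ) (y : Fin n →₀ ℕ) :
    {α : Monomials g →₀ ℕ | (α.sum fun m k => k • m.1) = y ∧
      MvPowerSeries.coeff (α.embDomain e) f.1 ≠ 0}.Finite := by
  obtain ⟨N, hN⟩ := f.2.2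
  classical
  let S : Finset (Monomials g) := (Finset.Iic y).sigma fun _ => Finset.univ
  let β : Monomials g →₀ ℕ := Finsupp.indicator S fun _ _ => N
  refine (Set.finite_Iic β).subset ?_
  rintro α ⟨hy, hα⟩ m
  by_cases h0 : α m = 0
  · rw [h0]; exact Nat.zero_le _
  have hle : m.1 ≤ y := by
    rw [← hy]
    calc m.1 = 1 • m.1 := (one_smul _ _).symm
      _ ≤ α m • m.1 := by
        intro i
        simpa using Nat.le_mul_of_pos_left (m.1 i) (Nat.pos_of_ne_zero h0)
      _ ≤ _ := Finset.single_le_sum (f := fun m => α m • m.1) (fun _ _ => zero_le)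
        (Finsupp.mem_support_iff.mpr h0)
  have hm : m ∈ S := by simp [S, hle]
  have hβ : β m = N := by simp [β, hm]
  rw [hβ]
  calc α m = α.embDomain e (e m) := (Finsupp.embDomain_apply_self _ _ _).symm
    _ ≤ (α.embDomain e).degree := Finsupp.le_degree _ _
    _ ≤ N := hN _ hα

/-- The plethysm `f[g]` of a symmetric function `f` with a sum `g` of monic monomials. -/
def plethysm {n : ℕ} (f : SymmFun) (g : MvPowerSeries (Fin n) ℕ) : MvPowerSeries (Fin n) ℂ :=
  substMonomials f g (nonempty_embedding_nat (Monomials g)).some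

/-- The formal power series `H(t_1, …, t_n) = ∑_{k ≥ 0} h_k(t_1, …, t_n)`. -/
def H (n : ℕ) : MvPowerSeries (Fin n) ℕ :=
  fun x => ∑ᶠ k : ℕ, (MvPolynomial.hsymm (Fin n) ℕ k).coeff x

end PolyInd

end

/-! Both sides are averages over `w` in `S_n` weighted by the character of `V`, and they agree term
by term in `w`.

Left side: averaging `f(Q) ↦ ρ(w) f(w⁻¹Q)` over `S_n` projects `P^d(M_n) ⊗ V` onto `Ind^d V`. The
trace of `diag(t)` on the image is therefore the trace of `diag(t)` times the projection on the
whole tensor product, where each summand splits as the trace of `ρ(w)` times the trace of `diag(t) ∘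
w` on `P^d(M_n)` (`trace_indRep`). Monomials `q^A` are indexed by matrices `A` of natural numbers;
`diag(t)` scales `q^A` by `t` to the column sums of `A`, and `w` permutes the rows of `A`. So the
coefficient of `t^x` in the `w`-term counts the `w`-invariant matrices with column sums `x`
(`coeff_chFamily_Ind`).

Right side: `f ↦ f[H]` is an algebra homomorphism (`plethysmHom`), and every monomial occurs exactly
once in `H` (`coeff_H`), so `p_k[H]` is the sum of all `t^{kx}` (`plethysm_psum`). Hence
`p_{λ(w)}[H]` is a product over the cycles of `w`, whose coefficient at `t^y` counts the choices of
one row `B c` per cycle `c` with `∑ |c| B c = y`. Repeating each row along its cycle turns such a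
choice into a `w`-invariant matrix with column sums `y` (`card_invariantMatrices`). -/

noncomputable section

namespace PolyInd

/-! ### Averaging over `S_n` and the trace on `Ind^d V` -/

section Average

variable {n : ℕ} {V : Type*} [AddCommGroup V] [Module ℂ V]

theorem evalAt_tmul (d : ℕ) (Q : Matrix (Fin n) (Fin n) ℂ) (p : HomPoly n d) (v : V) :
    evalAt d Q (p ⊗ₜ[ℂ] v) = MvPolynomial.eval (fun ij => Q ij.1 ij.2) (HomPoly.incl n d p) • v := by
  rw [← MvPolynomial.coe_aeval_eq_eval]
  rfl

/-- A `V`-valued polynomial is determined by its values. -/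
theorem eq_zero_of_evalAt_eq_zero [FiniteDimensional ℂ V] {d : ℕ} {f : HomPoly n d ⊗[ℂ] V}
    (hf : ∀ Q, evalAt d Q f = 0) : f = 0 := by
  classical
  -- In coordinates with respect to a basis of `V`, the claim becomes that a scalar polynomial over
  -- the infinite field `ℂ` vanishes if all its values do.
  let b := Module.finBasis ℂ V
  refine (TensorProduct.equivFinsuppOfBasisRight (M := HomPoly n d) b).injective ?_
  have key : ∀ (f : HomPoly n d ⊗[ℂ] V) (Q : Matrix (Fin n) (Fin n) ℂ) i,
      MvPolynomial.eval (fun ij => Q ij.1 ij.2)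
        (HomPoly.incl n d (TensorProduct.equivFinsuppOfBasisRight b f i)) =
      b.repr (evalAt d Q f) i := by
    intro f Q i
    induction f with
    | zero => simp
    | add f g hf hg => simp only [map_add, Finsupp.add_apply, hf, hg]
    | tmul p v =>
      rw [evalAt_tmul, TensorProduct.equivFinsuppOfBasisRight_apply_tmul_apply]
      simp [mul_comm]
  rw [map_zero]
  ext i
  refine HomPoly.incl_injective n d (MvPolynomial.funext fun x => ?_)
  have := key f (Matrix.of fun i j => x (i, j)) i
  rw [hf] at this
  simpa using this

theorem eq_of_evalAt_eq [FiniteDimensional ℂ V] {d : ℕ} {f g : HomPoly n d ⊗[ℂ] V}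
    (h : ∀ Q, evalAt d Q f = evalAt d Q g) : f = g :=
  sub_eq_zero.mp (eq_zero_of_evalAt_eq_zero fun Q => by rw [map_sub, h, sub_self])

/-- The substitution `q_{ij} ↦ q_{w(i) j}`, that is `p(Q) ↦ p(w⁻¹ Q)`, on `P^d(M_n)`. -/
def permuteRows (d : ℕ) (w : Equiv.Perm (Fin n)) : HomPoly n d →ₗ[ℂ] HomPoly n d :=
  ((MvPolynomial.rename (Prod.map w id)).toLinearMap ∘ₗ HomPoly.incl n d).codRestrict
    (MvPolynomial.homogeneousSubmodule (Fin n × Fin n) ℂ d)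
    fun p => p.isHomogeneous.rename_isHomogeneous

theorem incl_permuteRows (d : ℕ) (w : Equiv.Perm (Fin n)) (p : HomPoly n d) :
    HomPoly.incl n d (permuteRows d w p) =
      MvPolynomial.rename (Prod.map w id) (HomPoly.incl n d p) := rfl

theorem permMat_mul_apply (w : Equiv.Perm (Fin n)) (Q : Matrix (Fin n) (Fin n) ℂ) (i j : Fin n) :
    (permMat w * Q) i j = Q (w⁻¹ i) j := by
  simp [permMat, Equiv.Perm.permMatrix, PEquiv.toMatrix_toPEquiv_mul]

theorem permMat_mul (w w' : Equiv.Perm (Fin n)) : permMat (w * w') = permMat w * permMat w' := by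
  rw [permMat, permMat, permMat, mul_inv_rev, Matrix.permMatrix_mul]

theorem permMat_one : permMat (1 : Equiv.Perm (Fin n)) = 1 := by
  simp [permMat]

theorem evalAt_map_permuteRows (d : ℕ) (w : Equiv.Perm (Fin n)) (φ : V →ₗ[ℂ] V)
    (Q : Matrix (Fin n) (Fin n) ℂ) (f : HomPoly n d ⊗[ℂ] V) :
    evalAt d Q (TensorProduct.map (permuteRows d w) φ f) = φ (evalAt d (permMat w⁻¹ * Q) f) := by
  induction f with
  | zero => simp
  | add f g hf hg => simp only [map_add, hf, hg]
  | tmul p v =>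
    rw [TensorProduct.map_tmul, evalAt_tmul, evalAt_tmul, incl_permuteRows,
      MvPolynomial.eval_rename, map_smul]
    congr 3
    funext ij
    simp [permMat_mul_apply]

/-- The projection of `P^d(M_n) ⊗ V` onto `Ind^d V` obtained by averaging over `S_n`. -/
def average (d : ℕ) (ρ : Representation ℂ (Equiv.Perm (Fin n)) V) :
    HomPoly n d ⊗[ℂ] V →ₗ[ℂ] HomPoly n d ⊗[ℂ] V :=
  (n.factorial : ℂ)⁻¹ • ∑ w : Equiv.Perm (Fin n), TensorProduct.map (permuteRows d w) (ρ w)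

theorem evalAt_average (d : ℕ) (ρ : Representation ℂ (Equiv.Perm (Fin n)) V)
    (Q : Matrix (Fin n) (Fin n) ℂ) (f : HomPoly n d ⊗[ℂ] V) :
    evalAt d Q (average d ρ f) =
      (n.factorial : ℂ)⁻¹ • ∑ w : Equiv.Perm (Fin n), ρ w (evalAt d (permMat w⁻¹ * Q) f) := by
  simp only [average, LinearMap.smul_apply, LinearMap.sum_apply, map_smul, map_sum,
    evalAt_map_permuteRows]

theorem average_mem (d : ℕ) (ρ : Representation ℂ (Equiv.Perm (Fin n)) V)
    (f : HomPoly n d ⊗[ℂ] V) : average d ρ f ∈ indSpace d ρ := by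
  intro w Q
  rw [evalAt_average, evalAt_average, map_smul, map_sum]
  congr 1
  -- The term `ρ(u) f(u⁻¹ w Q)` on the left matches the term of index `w⁻¹u` on the right, because
  -- `(w⁻¹u)⁻¹ = u⁻¹w`.
  refine Fintype.sum_equiv (Equiv.mulLeft w⁻¹) _ _ fun u => ?_
  simp only [Equiv.coe_mulLeft]
  rw [← Module.End.mul_apply, ← map_mul, mul_inv_cancel_left, ← mul_assoc, ← permMat_mul,
    mul_inv_rev, inv_inv]

/-- Equivariance makes each of the `n!` terms of the average equal to `f(Q)`. With `average_mem`
this makes `average` a projection onto `indSpace`. -/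
theorem average_eq_self [FiniteDimensional ℂ V] {d : ℕ}
    {ρ : Representation ℂ (Equiv.Perm (Fin n)) V} {f : HomPoly n d ⊗[ℂ] V}
    (hf : f ∈ indSpace d ρ) : average d ρ f = f := by
  refine eq_of_evalAt_eq fun Q => ?_
  have h : ∀ w, ρ w (evalAt d (permMat w⁻¹ * Q) f) = evalAt d Q f := fun w => by
    rw [← hf w, ← mul_assoc, ← permMat_mul, mul_inv_cancel, permMat_one, one_mul]
  rw [evalAt_average, Finset.sum_congr rfl fun w _ => h w, Finset.sum_const, Finset.card_univ,
    Fintype.card_perm, Fintype.card_fin, ← Nat.cast_smul_eq_nsmul ℂ, smul_smul,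
    inv_mul_cancel₀ (Nat.cast_ne_zero.mpr n.factorial_ne_zero), one_smul]

/-- An operator with values in a subspace has the same trace as its restriction to that subspace.
Here the operator is translation by `g` after averaging, which restricts to the action of `g` on
`Ind^d V`; each summand is a tensor product of maps, so its trace factors. -/
theorem trace_indRep [FiniteDimensional ℂ V] (d : ℕ)
    (ρ : Representation ℂ (Equiv.Perm (Fin n)) V) (g : Matrix.GeneralLinearGroup (Fin n) ℂ) :
    LinearMap.trace ℂ (indSpace d ρ) (indRep d ρ g) =
      (n.factorial : ℂ)⁻¹ * ∑ w : Equiv.Perm (Fin n), LinearMap.trace ℂ V (ρ w) *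
        LinearMap.trace ℂ (HomPoly n d) (translateHom d g.1 ∘ₗ permuteRows d w) := by
  have hmem : ∀ f, ((translateHom d g.1).rTensor V ∘ₗ average d ρ) f ∈ indSpace d ρ :=
    fun f => (indRep d ρ g ⟨_, average_mem d ρ f⟩).2
  have hrestrict : indRep d ρ g =
      ((translateHom d g.1).rTensor V ∘ₗ average d ρ).restrict fun f _ => hmem f := by
    ext1 f
    refine Subtype.ext ?_
    change (translateHom d g.1).rTensor V f.1 = (translateHom d g.1).rTensor V (average d ρ f.1)
    rw [average_eq_self f.2]
  rw [hrestrict, LinearMap.trace_restrict_eq_of_forall_mem _ _ hmem, average, LinearMap.comp_smul,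
    map_smul, smul_eq_mul, ← Module.End.mul_eq_comp, Finset.mul_sum, map_sum]
  congr 1
  refine Finset.sum_congr rfl fun w _ => ?_
  rw [Module.End.mul_eq_comp, LinearMap.rTensor, ← TensorProduct.map_comp, LinearMap.id_comp,
    LinearMap.trace_tensorProduct', mul_comm]

end Average

/-! ### The monomial basis of `P^d(M_n)` -/

section Monomials

variable {n : ℕ}

/-- The monomials of degree `d` in the entries `q_{ij}`. -/
def HomPoly.monomial {d : ℕ} (A : {A : Fin n × Fin n →₀ ℕ // A.degree = d}) : HomPoly n d :=
  ⟨MvPolynomial.monomial A.1 1, MvPolynomial.isHomogeneous_monomial 1 A.2⟩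

theorem HomPoly.incl_monomial {d : ℕ} (A : {A : Fin n × Fin n →₀ ℕ // A.degree = d}) :
    incl n d (monomial A) = MvPolynomial.monomial A.1 1 := rfl

/-- The basis of `P^d(M_n)` consisting of the monomials. -/
def HomPoly.basis (n d : ℕ) :
    Module.Basis {A : Fin n × Fin n →₀ ℕ // A.degree = d} ℂ (HomPoly n d) :=
  Module.Basis.mk (v := HomPoly.monomial)
    (LinearIndependent.of_comp (incl n d) <| by
      have := (MvPolynomial.basisMonomials (Fin n × Fin n) ℂ).linearIndependent.comp
        (Subtype.val : {A : Fin n × Fin n →₀ ℕ // A.degree = d} → _) Subtype.val_injective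
      rwa [MvPolynomial.coe_basisMonomials] at this)
    (by
      rintro p -
      have hp : p = ∑ A ∈ (incl n d p).support.attach,
          (incl n d p).coeff A.1 • HomPoly.monomial
            (⟨A.1, by
              by_contra h
              exact (MvPolynomial.mem_support_iff.mp A.2) (p.isHomogeneous.coeff_eq_zero h)⟩ :
              {A : Fin n × Fin n →₀ ℕ // A.degree = d}) := by
        refine incl_injective n d ?_
        rw [map_sum]
        conv_lhs => rw [(incl n d p).as_sum, ← Finset.sum_attach]
        refine Finset.sum_congr rfl fun A _ => ?_
        rw [map_smul, incl_monomial, MvPolynomial.smul_monomial, smul_eq_mul, mul_one]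
      rw [hp]
      exact Submodule.sum_mem _ fun A _ =>
        Submodule.smul_mem _ _ (Submodule.subset_span (Set.mem_range_self _)))

theorem HomPoly.basis_apply {d : ℕ} (A : {A : Fin n × Fin n →₀ ℕ // A.degree = d}) :
    basis n d A = monomial A := by
  rw [basis, Module.Basis.mk_apply]

/-- These exponents index a basis of a space already known to be finite dimensional. -/
instance (n d : ℕ) : Finite {A : Fin n × Fin n →₀ ℕ // A.degree = d} :=
  Module.Finite.finite_basis (HomPoly.basis n d)

instance (n d : ℕ) : Fintype {A : Fin n × Fin n →₀ ℕ // A.degree = d} := Fintype.ofFinite _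

/-- Right multiplication by `diag(t)` scales `q_{ij}` by `t_j`, so every monomial is a weight
vector; `A.mapDomain Prod.snd` is the vector of column sums of `A`. -/
theorem translate_diagonal_monomial (t : Fin n → ℂ) (A : Fin n × Fin n →₀ ℕ) :
    translate (Matrix.diagonal t) (MvPolynomial.monomial A 1) =
      (A.mapDomain Prod.snd).prod (fun j k => t j ^ k) • MvPolynomial.monomial A 1 := by
  have h : ∀ ij : Fin n × Fin n,
      ∑ k, MvPolynomial.X (ij.1, k) * MvPolynomial.C (Matrix.diagonal t k ij.2) =
        (MvPolynomial.C (t ij.2) * MvPolynomial.X ij : MvPolynomial (Fin n × Fin n) ℂ) := by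
    intro ij
    rw [Finset.sum_eq_single ij.2 (fun k _ hk => by rw [Matrix.diagonal_apply_ne _ hk]; simp)
      (by simp), Matrix.diagonal_apply_eq, mul_comm]
  rw [translate, MvPolynomial.aeval_monomial, map_one, one_mul,
    Finsupp.prod_mapDomain_index (fun _ => pow_zero _) (fun _ _ _ => pow_add _ _ _)]
  simp only [h, mul_pow]
  rw [Finsupp.prod_mul, MvPolynomial.monomial_eq, map_one, one_mul, MvPolynomial.smul_eq_C_mul]
  congr 1
  simp [Finsupp.prod, map_prod]

open Classical in
/-- The trace of `diag(t) ∘ w` on `P^d(M_n)`: only the monomials fixed by `w` contribute. -/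
theorem trace_translateHom_comp_permuteRows (d : ℕ) (w : Equiv.Perm (Fin n)) (t : Fin n → ℂ) :
    LinearMap.trace ℂ (HomPoly n d) (translateHom d (Matrix.diagonal t) ∘ₗ permuteRows d w) =
      ∑ A : {A : Fin n × Fin n →₀ ℕ // A.degree = d},
        if A.1.mapDomain (Prod.map w id) = A.1 then
          (A.1.mapDomain Prod.snd).prod (fun j k => t j ^ k) else 0 := by
  rw [LinearMap.trace_eq_matrix_trace ℂ (HomPoly.basis n d), Matrix.trace]
  refine Finset.sum_congr rfl fun A _ => ?_
  have hdeg : (A.1.mapDomain (Prod.map w id)).degree = d := by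
    rw [Finsupp.degree_mapDomain, A.2]
  -- The operator takes each basis element to a multiple of a basis element, so a diagonal entry is
  -- nonzero only if `A` is fixed by `w`.
  have h : (translateHom d (Matrix.diagonal t) ∘ₗ permuteRows d w) (HomPoly.basis n d A) =
      ((A.1.mapDomain (Prod.map w id)).mapDomain Prod.snd).prod (fun j k => t j ^ k) •
        HomPoly.basis n d ⟨A.1.mapDomain (Prod.map w id), hdeg⟩ := by
    refine HomPoly.incl_injective n d ?_
    rw [LinearMap.comp_apply, incl_translateHom, incl_permuteRows, map_smul, HomPoly.basis_apply,
      HomPoly.basis_apply, HomPoly.incl_monomial, HomPoly.incl_monomial,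
      MvPolynomial.rename_monomial, translate_diagonal_monomial]
  rw [Matrix.diag_apply, LinearMap.toMatrix_apply, h, map_smul, Module.Basis.repr_self,
    Finsupp.smul_apply, Finsupp.single_apply]
  simp only [Subtype.ext_iff]
  split_ifs with hA
  · rw [hA, smul_eq_mul, mul_one]
  · rw [smul_zero]

end Monomials

/-! ### The character of `Ind V` as a count of invariant matrices -/

section Character

variable {n : ℕ} {V : Type*} [AddCommGroup V] [Module ℂ V] [FiniteDimensional ℂ V]

/-- The `w`-invariant `n × n` matrices of natural numbers with column sums `x`. -/
abbrev InvariantMatrices (w : Equiv.Perm (Fin n)) (x : Fin n →₀ ℕ) : Type :=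
  {A : Fin n × Fin n →₀ ℕ // A.mapDomain (Prod.map w id) = A ∧ A.mapDomain Prod.snd = x}

open Classical in
theorem ch_Ind (d : ℕ) (ρ : Representation ℂ (Equiv.Perm (Fin n)) V) :
    (Ind d ρ).ch = (n.factorial : ℂ)⁻¹ • ∑ w : Equiv.Perm (Fin n), LinearMap.trace ℂ V (ρ w) •
      ∑ A : {A : Fin n × Fin n →₀ ℕ // A.degree = d},
        if A.1.mapDomain (Prod.map w id) = A.1 then
          MvPolynomial.monomial (A.1.mapDomain Prod.snd) 1 else 0 := by
  -- Traces give the values of the character only at points with nonzero coordinates; these suffice,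
  -- since the nonzero complex numbers are infinitely many.
  refine MvPolynomial.funext_set (fun _ => {0}ᶜ) (fun _ => (Set.finite_singleton 0).infinite_compl)
    fun x hx => ?_
  let t : Fin n → ℂˣ := fun i => Units.mk0 (x i) (hx i trivial)
  have ht : (diagGL t).1 = Matrix.diagonal x := rfl
  refine ((Ind d ρ).eval_ch t).trans ((trace_indRep d ρ (diagGL t)).trans ?_)
  simp only [ht, trace_translateHom_comp_permuteRows, MvPolynomial.smul_eval, map_sum]
  congr 1
  refine Finset.sum_congr rfl fun w _ => ?_
  congr 1
  refine Finset.sum_congr rfl fun A _ => ?_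
  split_ifs
  · rw [MvPolynomial.eval_monomial, one_mul]
  · rw [map_zero]

theorem coeff_chFamily_Ind (ρ : Representation ℂ (Equiv.Perm (Fin n)) V) (x : Fin n →₀ ℕ) :
    MvPowerSeries.coeff x (chFamily fun d => Ind d ρ) =
      (n.factorial : ℂ)⁻¹ * ∑ w : Equiv.Perm (Fin n), LinearMap.trace ℂ V (ρ w) *
        (Nat.card (InvariantMatrices w x) : ℂ) := by
  classical
  change ∑ᶠ d : ℕ, (Ind d ρ).ch.coeff x = _
  -- By homogeneity only `d = |x|` contributes to the coefficient of `t^x`.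
  rw [finsum_eq_single _ x.degree fun d hd => (Ind d ρ).isHomogeneous_ch.coeff_eq_zero hd.symm,
    ch_Ind, MvPolynomial.coeff_smul, smul_eq_mul, MvPolynomial.coeff_sum]
  congr 1
  refine Finset.sum_congr rfl fun w _ => ?_
  rw [MvPolynomial.coeff_smul, smul_eq_mul, MvPolynomial.coeff_sum]
  congr 1
  -- Column sums `x` already force the degree `|x|`, so the degree condition is redundant.
  let e : InvariantMatrices w x ≃ {A : {A : Fin n × Fin n →₀ ℕ // A.degree = x.degree} //
      A.1.mapDomain (Prod.map w id) = A.1 ∧ A.1.mapDomain Prod.snd = x} :=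
    { toFun A := ⟨⟨A.1, by
          rw [← Finsupp.degree_mapDomain Prod.snd, A.2.2]⟩, A.2⟩
      invFun A := ⟨A.1.1, A.2⟩ }
  rw [Nat.card_congr e, Nat.card_eq_fintype_card, Fintype.card_subtype, Finset.card_filter,
    Nat.cast_sum]
  refine Finset.sum_congr rfl fun A _ => ?_
  by_cases h₁ : A.1.mapDomain (Prod.map w id) = A.1 <;>
    simp [h₁, MvPolynomial.coeff_monomial]

end Character

/-! ### Plethysm as an algebra homomorphism -/

section Plethysm

variable {n : ℕ} (g : MvPowerSeries (Fin n) ℕ) (e : Monomials g ↪ ℕ)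

/-- The exponent of the product `∏_m (t^{x_m})^{α_m}` of monomials of `g`. -/
def totalExponent (α : Monomials g →₀ ℕ) : Fin n →₀ ℕ := α.sum fun m k => k • m.1

theorem totalExponent_add (α β : Monomials g →₀ ℕ) :
    totalExponent g (α + β) = totalExponent g α + totalExponent g β :=
  Finsupp.sum_add_index' (fun _ => zero_smul _ _) fun _ _ _ => add_smul _ _ _

theorem totalExponent_single (m : Monomials g) (k : ℕ) :
    totalExponent g (Finsupp.single m k) = k • m.1 :=
  Finsupp.sum_single_index (zero_smul _ _)

theorem coeff_substMonomials (f : SymmFun) (y : Fin n →₀ ℕ) :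
    MvPowerSeries.coeff y (substMonomials f g e) =
      ∑ᶠ (α : Monomials g →₀ ℕ) (_ : totalExponent g α = y),
        MvPowerSeries.coeff (α.embDomain e) f.1 := rfl

/-- The sum defining a coefficient of `substMonomials f g e`, over any finite set of `α` which
contains all that contribute. -/
theorem coeff_substMonomials_eq_sum (f : SymmFun) (y : Fin n →₀ ℕ)
    (T : Finset (Monomials g →₀ ℕ)) (hT : ∀ α ∈ T, totalExponent g α = y)
    (hT' : ∀ α, totalExponent g α = y → MvPowerSeries.coeff (α.embDomain e) f.1 ≠ 0 → α ∈ T) :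
    MvPowerSeries.coeff y (substMonomials f g e) =
      ∑ α ∈ T, MvPowerSeries.coeff (α.embDomain e) f.1 := by
  rw [coeff_substMonomials]
  refine (finsum_mem_eq_sum_of_inter_support_eq (s := {α | totalExponent g α = y}) _ ?_)
  ext α
  simp only [Set.mem_inter_iff, Set.mem_ofPred_eq, Function.mem_support, Finset.mem_coe]
  exact ⟨fun h => ⟨hT' α h.1 h.2, h.2⟩, fun h => ⟨hT α h.1, h.2⟩⟩

/-- The exponents `α` that contribute to the coefficient of `t^y` in `substMonomials f g e`. -/
def contributing (f : SymmFun) (y : Fin n →₀ ℕ) : Finset (Monomials g →₀ ℕ) :=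
  (substMonomials_finite f g e y).toFinset

theorem mem_contributing (f : SymmFun) (y : Fin n →₀ ℕ) (α : Monomials g →₀ ℕ) :
    α ∈ contributing g e f y ↔
      totalExponent g α = y ∧ MvPowerSeries.coeff (α.embDomain e) f.1 ≠ 0 := by
  rw [contributing, Set.Finite.mem_toFinset]
  rfl

theorem coeff_substMonomials_eq_sum_contributing (f : SymmFun) (y : Fin n →₀ ℕ) :
    MvPowerSeries.coeff y (substMonomials f g e) =
      ∑ α ∈ contributing g e f y, MvPowerSeries.coeff (α.embDomain e) f.1 :=
  coeff_substMonomials_eq_sum g e f y _ (fun _ h => ((mem_contributing g e f y _).mp h).1)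
    fun _ h h' => (mem_contributing g e f y _).mpr ⟨h, h'⟩

theorem substMonomials_add (f₁ f₂ : SymmFun) :
    substMonomials (f₁ + f₂) g e = substMonomials f₁ g e + substMonomials f₂ g e := by
  classical
  ext y
  -- A common finite index set for all three coefficients: outside it both `f₁` and `f₂` contribute
  -- zero, hence so does their sum.
  let T := contributing g e f₁ y ∪ contributing g e f₂ y
  have hT : ∀ α ∈ T, totalExponent g α = y := by
    intro α hα
    rcases Finset.mem_union.mp hα with h | h <;> exact ((mem_contributing g e _ y _).mp h).1
  rw [map_add, coeff_substMonomials_eq_sum g e f₁ y T hT fun α h h' =>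
      Finset.mem_union_left _ ((mem_contributing g e _ y _).mpr ⟨h, h'⟩),
    coeff_substMonomials_eq_sum g e f₂ y T hT fun α h h' =>
      Finset.mem_union_right _ ((mem_contributing g e _ y _).mpr ⟨h, h'⟩),
    coeff_substMonomials_eq_sum g e (f₁ + f₂) y T hT, ← Finset.sum_add_distrib]
  · rfl
  · intro α h h'
    rw [Finset.mem_union, mem_contributing, mem_contributing]
    by_contra hα
    rw [not_or, not_and_not_right, not_and_not_right] at hα
    apply h'
    change MvPowerSeries.coeff _ (f₁.1 + f₂.1) = 0
    rw [map_add, hα.1 h, hα.2 h, add_zero]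

/-- Setting the variables outside the range of `e` to zero is a ring homomorphism, and the
coefficients of the result are those at exponents of the form `α.embDomain e`. -/
theorem coeff_embDomain_mul {σ τ R : Type*} [CommSemiring R] [DecidableEq σ] (e : σ ↪ τ)
    (p q : MvPowerSeries τ R) (α : σ →₀ ℕ) :
    MvPowerSeries.coeff (α.embDomain e) (p * q) =
      ∑ x ∈ Finset.HasAntidiagonal.antidiagonal α, MvPowerSeries.coeff (x.1.embDomain e) p *
        MvPowerSeries.coeff (x.2.embDomain e) q := by
  rw [← MvPowerSeries.coeff_killCompl, map_mul, MvPowerSeries.coeff_mul]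
  simp only [MvPowerSeries.coeff_killCompl]

/-- Both sides are the sum of products of coefficients over the pairs in `P`. On the right the pairs
are grouped by their two total exponents, on the left by their sum `α`; additivity of
`totalExponent` reconciles the two groupings. -/
theorem substMonomials_mul (f₁ f₂ : SymmFun) :
    substMonomials (f₁ * f₂) g e = substMonomials f₁ g e * substMonomials f₂ g e := by
  classical
  ext y
  let P : Finset ((Monomials g →₀ ℕ) × (Monomials g →₀ ℕ)) :=
    (Finset.HasAntidiagonal.antidiagonal y).biUnion fun u => contributing g e f₁ u.1 ×ˢ contributing g e f₂ u.2
  have hP : ∀ x, x ∈ P ↔ totalExponent g (x.1 + x.2) = y ∧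
      MvPowerSeries.coeff (x.1.embDomain e) f₁.1 ≠ 0 ∧
      MvPowerSeries.coeff (x.2.embDomain e) f₂.1 ≠ 0 := by
    intro x
    simp only [P, Finset.mem_biUnion, Finset.mem_product, mem_contributing,
      Finset.HasAntidiagonal.mem_antidiagonal, totalExponent_add, Prod.exists]
    constructor
    · rintro ⟨a, b, h, ⟨rfl, h₁⟩, rfl, h₂⟩
      exact ⟨h, h₁, h₂⟩
    · rintro ⟨h, h₁, h₂⟩
      exact ⟨_, _, h, ⟨rfl, h₁⟩, rfl, h₂⟩
  have hR : MvPowerSeries.coeff y (substMonomials f₁ g e * substMonomials f₂ g e) =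
      ∑ x ∈ P, MvPowerSeries.coeff (x.1.embDomain e) f₁.1 *
        MvPowerSeries.coeff (x.2.embDomain e) f₂.1 := by
    rw [MvPowerSeries.coeff_mul, Finset.sum_biUnion]
    · refine Finset.sum_congr rfl fun u _ => ?_
      rw [coeff_substMonomials_eq_sum_contributing, coeff_substMonomials_eq_sum_contributing,
        Finset.sum_mul_sum, Finset.sum_product]
    · intro u _ v _ huv
      rw [Function.onFun, Finset.disjoint_left]
      intro x hx hx'
      simp only [Finset.mem_product, mem_contributing] at hx hx'
      exact huv (Prod.ext (hx.1.1.symm.trans hx'.1.1) (hx.2.1.symm.trans hx'.2.1))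
  refine (coeff_substMonomials_eq_sum g e (f₁ * f₂) y (P.image fun x => x.1 + x.2)
    ?_ ?_).trans (Eq.trans ?_ ((Finset.sum_fiberwise_of_maps_to (fun x hx =>
      Finset.mem_image_of_mem (fun x => x.1 + x.2) hx) _).trans hR.symm))
  · intro α hα
    obtain ⟨x, hx, rfl⟩ := Finset.mem_image.mp hα
    exact ((hP x).mp hx).1
  · intro α hα h
    obtain ⟨x, hx, hne⟩ := Finset.exists_ne_zero_of_sum_ne_zero
      ((coeff_embDomain_mul e f₁.1 f₂.1 α).symm.trans_ne h)
    have hx := Finset.HasAntidiagonal.mem_antidiagonal.mp hx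
    exact Finset.mem_image.mpr ⟨x, (hP x).mpr ⟨hx ▸ hα, left_ne_zero_of_mul hne,
      right_ne_zero_of_mul hne⟩, hx⟩
  -- The fibre of `P` over `α` is the antidiagonal of `α` without pairs whose product of
  -- coefficients vanishes.
  · refine Finset.sum_congr rfl fun α hα => ?_
    obtain ⟨x₀, hx₀, rfl⟩ := Finset.mem_image.mp hα
    refine (coeff_embDomain_mul e f₁.1 f₂.1 _).trans (Finset.sum_subset ?_ ?_).symm
    · intro x hx
      exact Finset.HasAntidiagonal.mem_antidiagonal.mpr (Finset.mem_filter.mp hx).2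
    · intro x hx hx'
      by_contra h
      have hx := Finset.HasAntidiagonal.mem_antidiagonal.mp hx
      refine hx' (Finset.mem_filter.mpr ⟨(hP x).mpr ⟨?_, left_ne_zero_of_mul h,
        right_ne_zero_of_mul h⟩, hx⟩)
      rw [hx]
      exact ((hP x₀).mp hx₀).1

theorem substMonomials_algebraMap (c : ℂ) :
    substMonomials (algebraMap ℂ SymmFun c) g e = algebraMap ℂ (MvPowerSeries (Fin n) ℂ) c := by
  classical
  ext y
  have hc : ∀ α : Monomials g →₀ ℕ,
      MvPowerSeries.coeff (α.embDomain e) (algebraMap ℂ SymmFun c).1 = if α = 0 then c else 0 := by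
    intro α
    change MvPowerSeries.coeff _ (algebraMap ℂ (MvPowerSeries ℕ ℂ) c) = _
    rw [MvPowerSeries.algebraMap_apply, MvPowerSeries.coeff_C]
    simp [Finsupp.embDomain_eq_zero]
  have h0 : totalExponent g 0 = 0 := Finsupp.sum_zero_index
  rw [coeff_substMonomials_eq_sum g e _ y (if y = 0 then {0} else ∅),
    MvPowerSeries.algebraMap_apply, MvPowerSeries.coeff_C]
  · split_ifs
    · rw [Finset.sum_singleton, hc, if_pos rfl]
      rfl
    · rfl
  · intro α hα
    split_ifs at hα with hy
    · rw [Finset.mem_singleton.mp hα, h0, hy]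
    · simp at hα
  · intro α h h'
    have hα : α = 0 := by
      by_contra hα
      exact h' (by rw [hc, if_neg hα])
    rw [if_pos (by rw [← h, hα, h0]), hα, Finset.mem_singleton]

/-- Plethysm with `g` is a homomorphism of algebras. -/
def plethysmHom : SymmFun →ₐ[ℂ] MvPowerSeries (Fin n) ℂ where
  toFun f := plethysm f g
  map_one' := by
    rw [← map_one (algebraMap ℂ SymmFun), plethysm, substMonomials_algebraMap, map_one]
  map_mul' f₁ f₂ := substMonomials_mul g _ f₁ f₂
  map_zero' := by
    rw [← map_zero (algebraMap ℂ SymmFun), plethysm, substMonomials_algebraMap, map_zero]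
  map_add' f₁ f₂ := substMonomials_add g _ f₁ f₂
  commutes' c := substMonomials_algebraMap g _ c

theorem plethysmHom_apply (f : SymmFun) : plethysmHom g f = plethysm f g := rfl

end Plethysm

/-! ### The series `H` and its plethysm with power sums -/

section CompleteSymmetric

variable {n : ℕ}

/-- The terms of `h_k` correspond to the multisets of size `k`, that is, to the monomials of degree
`k`; so `t^x` occurs once in `h_{|x|}` and in no other `h_k`. -/
theorem coeff_H (x : Fin n →₀ ℕ) : MvPowerSeries.coeff x (H n) = 1 := by
  classical
  have h : ∀ k, (MvPolynomial.hsymm (Fin n) ℕ k).coeff x = if k = x.degree then 1 else 0 := by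
    intro k
    have hm : ∀ s : Sym (Fin n) k,
        (s.1.map (MvPolynomial.X (R := ℕ))).prod = MvPolynomial.monomial s.1.toFinsupp 1 := by
      intro s
      generalize s.1 = s
      induction s using Multiset.induction with
      | empty => simp
      | cons a s ih =>
        rw [Multiset.map_cons, Multiset.prod_cons, ih, ← Multiset.singleton_add, map_add,
          Multiset.toFinsupp_singleton, MvPolynomial.X, MvPolynomial.monomial_mul, one_mul]
    rw [MvPolynomial.hsymm, MvPolynomial.coeff_sum]
    simp only [hm, MvPolynomial.coeff_monomial]
    split_ifs with hk
    · subst hk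
      have hcard : Multiset.card (Finsupp.toMultiset x) = x.degree := by
        rw [Finsupp.card_toMultiset]; rfl
      rw [Finset.sum_eq_single ⟨Finsupp.toMultiset x, hcard⟩]
      · simp
      · intro s _ hs
        refine if_neg fun h => hs (Subtype.ext ?_)
        change s.1 = Finsupp.toMultiset x
        exact (Multiset.toFinsupp_toMultiset s.1).symm.trans (congrArg _ h)
      · exact fun h => absurd (Finset.mem_univ _) h
    · refine Finset.sum_eq_zero fun s _ => if_neg fun h => hk ?_
      rw [← h]
      refine s.2.symm.trans ?_
      generalize s.1 = s
      conv_lhs => rw [← Multiset.toFinsupp_toMultiset s, Finsupp.card_toMultiset]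
      rfl
  change ∑ᶠ k : ℕ, (MvPolynomial.hsymm (Fin n) ℕ k).coeff x = 1
  rw [finsum_congr h, finsum_eq_single _ x.degree fun k hk => if_neg hk, if_pos rfl]

/-- The series `H(t_1^k, …, t_n^k)`, the sum of the `k`th powers of all monomials. -/
def powSeries (n k : ℕ) : MvPowerSeries (Fin n) ℂ :=
  open Classical in fun y => if ∃ x : Fin n →₀ ℕ, k • x = y then 1 else 0

open Classical in
theorem coeff_powSeries (k : ℕ) (y : Fin n →₀ ℕ) : MvPowerSeries.coeff y (powSeries n k) =
    if ∃ x : Fin n →₀ ℕ, k • x = y then 1 else 0 := rfl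

/-- Only exponents `single m k` contribute, each giving the `k`th power of the monomial `m`. These
powers are distinct, since `x ↦ kx` is injective and no monomial repeats in `H`. -/
theorem plethysm_psum {k : ℕ} (hk : k ≠ 0) : plethysm (psum k) (H n) = powSeries n k := by
  classical
  ext y
  rw [plethysm, coeff_powSeries]
  generalize (nonempty_embedding_nat (Monomials (H n))).some = e
  have hc : ∀ α : Monomials (H n) →₀ ℕ, MvPowerSeries.coeff (α.embDomain e) (psum k).1 =
      if ∃ m, α = Finsupp.single m k then 1 else 0 := by
    intro α
    refine (coeff_psumSeries k _).trans (if_congr ⟨?_, ?_⟩ rfl rfl)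
    · rintro ⟨i, hi⟩
      obtain ⟨m, hm, -⟩ := Finsupp.single_of_embDomain_single α e i k hk hi
      exact ⟨m, hm⟩
    · rintro ⟨m, rfl⟩
      exact ⟨e m, Finsupp.embDomain_single _ _ _⟩
  -- As the coefficients of `H` are all `1`, an exponent carries a single monomial.
  have hm : ∀ m m' : Monomials (H n), m.1 = m'.1 → m = m' := by
    rintro ⟨x, i⟩ ⟨x', i'⟩ h
    obtain rfl : x = x' := h
    have : Subsingleton (Fin (MvPowerSeries.coeff x (H n))) := by
      rw [coeff_H]; infer_instance
    rw [Subsingleton.elim i i']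
  split_ifs with h
  · obtain ⟨x, rfl⟩ := h
    let m : Monomials (H n) := ⟨x, ⟨0, by rw [coeff_H]; exact one_pos⟩⟩
    rw [coeff_substMonomials_eq_sum (H n) e _ _ {Finsupp.single m k}]
    · rw [Finset.sum_singleton, hc, if_pos ⟨m, rfl⟩]
    · intro α hα
      rw [Finset.mem_singleton.mp hα, totalExponent_single]
    · intro α h h'
      have : ∃ m, α = Finsupp.single m k := by
        by_contra hα
        exact h' (by rw [hc, if_neg hα])
      obtain ⟨m', rfl⟩ := this
      rw [totalExponent_single] at h
      rw [Finset.mem_singleton, hm m' m (smul_right_injective _ hk h)]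
  · rw [coeff_substMonomials_eq_sum (H n) e _ _ ∅ (by simp), Finset.sum_empty]
    intro α h' h''
    have : ∃ m, α = Finsupp.single m k := by
      by_contra hα
      exact h'' (by rw [hc, if_neg hα])
    obtain ⟨m, rfl⟩ := this
    exact absurd ⟨m.1, by rw [← h', totalExponent_single]⟩ h

end CompleteSymmetric

/-! ### Cycles of a permutation and its cycle type -/

section Cycles

variable {α : Type*} [Fintype α]

/-- The cycles of a permutation, fixed points included. -/
abbrev Cycles (w : Equiv.Perm α) : Type _ := Quotient (Equiv.Perm.SameCycle.setoid w)

instance (w : Equiv.Perm α) : Fintype (Cycles w) := Fintype.ofFinite _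

open Classical in
/-- The length of a cycle. -/
def cycleLength (w : Equiv.Perm α) (c : Cycles w) : ℕ :=
  (Finset.univ.filter fun a : α => (Quotient.mk _ a : Cycles w) = c).card

/-- Fixed points need a separate case: `cycleOf` is the identity there, with empty support, while
the orbit has one element. -/
theorem cycleLength_mk [DecidableEq α] (w : Equiv.Perm α) (a : α) :
    cycleLength w (Quotient.mk _ a) = if a ∈ w.support then (w.cycleOf a).support.card else 1 := by
  classical
  split_ifs with ha
  · refine congrArg Finset.card (Finset.ext fun b => ?_)
    rw [Equiv.Perm.mem_support_cycleOf_iff, Finset.mem_filter, Quotient.eq]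
    exact ⟨fun h => ⟨h.2.symm, ha⟩, fun h => ⟨Finset.mem_univ _, h.1.symm⟩⟩
  · refine Finset.card_eq_one.mpr ⟨a, Finset.ext fun b => ?_⟩
    rw [Finset.mem_filter, Quotient.eq, Finset.mem_singleton]
    constructor
    · rintro ⟨-, h⟩
      have h : w.SameCycle b a := h
      exact (h.symm.eq_of_left (Equiv.Perm.notMem_support.mp ha)).symm
    · rintro rfl
      exact ⟨Finset.mem_univ _, Equiv.Perm.SameCycle.refl _ _⟩

theorem cycleLength_ne_zero (w : Equiv.Perm α) (c : Cycles w) : cycleLength w c ≠ 0 := by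
  induction c using Quotient.inductionOn with
  | h a => exact (Finset.card_pos.mpr ⟨a, by simp⟩).ne'

/-- Grouping the points by their cycles. It serves both to add up the cycle lengths and to compute
the column sums of a matrix with repeated rows. -/
theorem sum_cycleLength_smul {M : Type*} [AddCommMonoid M] (w : Equiv.Perm α)
    (f : Cycles w → M) : ∑ c, cycleLength w c • f c = ∑ a, f (Quotient.mk _ a) := by
  classical
  rw [← Finset.sum_fiberwise Finset.univ (fun a : α => (Quotient.mk _ a : Cycles w))]
  refine Finset.sum_congr rfl fun c _ => ?_
  rw [Finset.sum_congr rfl fun a ha => congrArg f (Finset.mem_filter.mp ha).2, Finset.sum_const]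
  rfl

theorem cycleLength_mk_ne_one_iff [DecidableEq α] (w : Equiv.Perm α) (a : α) :
    cycleLength w (Quotient.mk _ a) ≠ 1 ↔ a ∈ w.support := by
  rw [cycleLength_mk]
  split_ifs with ha
  · have h := (Equiv.Perm.isCycle_cycleOf w (Equiv.Perm.mem_support.mp ha)).two_le_card_support
    exact iff_of_true (by lia) ha
  · exact iff_of_false (not_not.mpr rfl) ha

/-- The parts of the partition attached to a permutation are the lengths of its cycles. -/
theorem map_cycleLength [DecidableEq α] (w : Equiv.Perm α) :
    (Finset.univ : Finset (Cycles w)).val.map (cycleLength w) = w.partition.parts := by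
  classical
  let F : Cycles w → Equiv.Perm α := Quotient.lift w.cycleOf fun a b h => h.cycleOf_eq
  -- The nontrivial cycles, which `cycleType` records. `F` sends all fixed points to the identity,
  -- so injectivity is claimed only on `S`.
  let S : Finset (Cycles w) := Finset.univ.filter fun c => cycleLength w c ≠ 1
  have hS : ∀ a, (Quotient.mk _ a : Cycles w) ∈ S ↔ a ∈ w.support := fun a => by
    rw [Finset.mem_filter, cycleLength_mk_ne_one_iff]
    exact and_iff_right (Finset.mem_univ _)
  have hinj : Set.InjOn F S := by
    intro c hc c' hc' h
    induction c using Quotient.inductionOn with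
    | h a =>
    induction c' using Quotient.inductionOn with
    | h b =>
      exact Quotient.sound ((Equiv.Perm.sameCycle_iff_cycleOf_eq_of_mem_support
        ((hS a).mp hc) ((hS b).mp hc')).mpr h)
  have himage : S.image F = w.cycleFactorsFinset := by
    ext c
    rw [Finset.mem_image]
    constructor
    · rintro ⟨c, hc, rfl⟩
      induction c using Quotient.inductionOn with
      | h a => exact Equiv.Perm.cycleOf_mem_cycleFactorsFinset_iff.mpr ((hS a).mp hc)
    · intro hc
      obtain ⟨a, ha⟩ := (Equiv.Perm.mem_cycleFactorsFinset_iff.mp hc).1.nonempty_support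
      have hca := Equiv.Perm.cycle_is_cycleOf ha hc
      refine ⟨Quotient.mk _ a, (hS a).mpr ?_, hca.symm⟩
      exact Equiv.Perm.cycleOf_mem_cycleFactorsFinset_iff.mp (hca ▸ hc)
  have htype : S.val.map (cycleLength w) = w.cycleType := by
    rw [Equiv.Perm.cycleType_def, ← himage, Finset.image_val_of_injOn hinj, Multiset.map_map]
    refine Multiset.map_congr rfl fun c hc => ?_
    induction c using Quotient.inductionOn with
    | h a => rw [cycleLength_mk, if_pos ((hS a).mp hc)]; rfl
  have hsplit : (Finset.univ : Finset (Cycles w)).val.map (cycleLength w) = w.cycleType +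
      Multiset.replicate (Finset.univ.filter fun c => ¬ cycleLength w c ≠ 1).card 1 := by
    rw [← htype, ← Multiset.filter_add_not (fun c => cycleLength w c ≠ 1) Finset.univ.val,
      Multiset.map_add]
    congr 1
    refine Multiset.eq_replicate.mpr ⟨Multiset.card_map _ _, fun k hk => ?_⟩
    obtain ⟨c, hc, rfl⟩ := Multiset.mem_map.mp hk
    exact not_not.mp (Multiset.mem_filter.mp hc).2
  -- Comparing sums determines the number of parts `1`: the cycle lengths add up to the number of
  -- points, and `cycleType` adds up to the size of the support.
  have hsum := congrArg Multiset.sum hsplit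
  have htotal : ((Finset.univ : Finset (Cycles w)).val.map (cycleLength w)).sum =
      Fintype.card α := by
    have := sum_cycleLength_smul w fun _ => (1 : ℕ)
    simpa using this
  rw [htotal, Multiset.sum_add, Equiv.Perm.sum_cycleType, Multiset.sum_replicate, smul_eq_mul,
    mul_one] at hsum
  rw [hsplit, Equiv.Perm.parts_partition, hsum, Nat.add_sub_cancel_left]

end Cycles

/-! ### Invariant matrices as families of rows indexed by cycles -/

section Counting

variable {n : ℕ}

/-- A decomposition of `y` into summands `l i` contributes `1` when each `l i` is divisible by `k
i`, and `0` otherwise; since `k i ≠ 0`, the quotients `B i` are unique. -/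
theorem coeff_prod_powSeries {ι : Type*} [Fintype ι] (k : ι → ℕ) (hk : ∀ i, k i ≠ 0)
    (y : Fin n →₀ ℕ) : MvPowerSeries.coeff y (∏ i, powSeries n (k i)) =
      Nat.card {B : ι → Fin n →₀ ℕ // ∑ i, k i • B i = y} := by
  classical
  have hmem : ∀ l : ι →₀ Fin n →₀ ℕ,
      l ∈ Finset.univ.finsuppAntidiag y ↔ ∑ i, l i = y := fun l => by
    simp [Finset.mem_finsuppAntidiag]
  let S := (Finset.univ.finsuppAntidiag y).filter fun l : ι →₀ Fin n →₀ ℕ =>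
    ∀ i ∈ Finset.univ, ∃ x : Fin n →₀ ℕ, k i • x = l i
  have hS : MvPowerSeries.coeff y (∏ i, powSeries n (k i)) = (S.card : ℂ) := by
    rw [MvPowerSeries.coeff_prod, Finset.card_filter, Nat.cast_sum]
    refine Finset.sum_congr rfl fun l _ => ?_
    simp only [coeff_powSeries, Finset.prod_ite_zero, Finset.prod_const_one, Nat.cast_ite,
      Nat.cast_one, Nat.cast_zero]
  have hmem' : ∀ B : {B : ι → Fin n →₀ ℕ // ∑ i, k i • B i = y},
      Finsupp.equivFunOnFinite.symm (fun i => k i • B.1 i) ∈ S := fun B =>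
    Finset.mem_filter.mpr ⟨(hmem _).mpr B.2, fun i _ => ⟨B.1 i, rfl⟩⟩
  rw [hS, Nat.card_eq_of_bijective (fun B => (⟨_, hmem' B⟩ : S)) ⟨?_, ?_⟩,
    Nat.card_eq_fintype_card, Fintype.card_coe]
  · intro B B' h
    have h := Finsupp.equivFunOnFinite.symm.injective (congrArg Subtype.val h)
    exact Subtype.ext (funext fun i => smul_right_injective _ (hk i) (congrFun h i))
  · rintro ⟨l, hl⟩
    obtain ⟨hl, h⟩ := Finset.mem_filter.mp hl
    choose B hB using fun i => h i (Finset.mem_univ i)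
    refine ⟨⟨B, ?_⟩, Subtype.ext (Finsupp.ext hB)⟩
    rw [Finset.sum_congr rfl fun i _ => hB i]
    exact (hmem l).mp hl

theorem mapDomain_snd_apply (A : Fin n × Fin n →₀ ℕ) (j : Fin n) :
    A.mapDomain Prod.snd j = ∑ i, A (i, j) := by
  classical
  rw [Finsupp.mapDomain, Finsupp.sum_fintype _ _ (by simp), Finsupp.finsetSum_apply,
    Fintype.sum_prod_type]
  refine Finset.sum_congr rfl fun i _ => ?_
  simp [Finsupp.single_apply]

theorem mapDomain_permuteRows_eq_self_iff (w : Equiv.Perm (Fin n)) (A : Fin n × Fin n →₀ ℕ) :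
    A.mapDomain (Prod.map w id) = A ↔ ∀ i j, A (w i, j) = A (i, j) := by
  have h : ∀ i j, A.mapDomain (Prod.map w id) (w i, j) = A (i, j) := fun i j =>
    Finsupp.mapDomain_apply (w.injective.prodMap Function.injective_id) A (i, j)
  constructor
  · intro hA i j
    conv_lhs => rw [← hA]
    exact h i j
  · intro hA
    ext ⟨i, j⟩
    obtain ⟨i, rfl⟩ := w.surjective i
    rw [h, hA]

/-- The matrix with the same row `B c` in all places of the cycle `c`. -/
def repeatRows (w : Equiv.Perm (Fin n)) (B : Cycles w → Fin n →₀ ℕ) : Fin n × Fin n →₀ ℕ :=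
  Finsupp.equivFunOnFinite.symm fun ij => B (Quotient.mk _ ij.1) ij.2

theorem repeatRows_apply (w : Equiv.Perm (Fin n)) (B : Cycles w → Fin n →₀ ℕ) (i j : Fin n) :
    repeatRows w B (i, j) = B (Quotient.mk _ i) j := by
  rw [repeatRows, Finsupp.equivFunOnFinite_symm_apply_apply]

theorem mapDomain_snd_repeatRows (w : Equiv.Perm (Fin n)) (B : Cycles w → Fin n →₀ ℕ) :
    (repeatRows w B).mapDomain Prod.snd = ∑ c, cycleLength w c • B c := by
  ext j
  rw [mapDomain_snd_apply, sum_cycleLength_smul, Finsupp.finsetSum_apply]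
  exact Finset.sum_congr rfl fun i _ => repeatRows_apply w B i j

theorem repeatRows_injective (w : Equiv.Perm (Fin n)) : Function.Injective (repeatRows w) := by
  refine fun B B' h => funext fun c => ?_
  induction c using Quotient.inductionOn with
  | h i =>
    ext j
    rw [← repeatRows_apply, h, repeatRows_apply]

/-- Invariance means that rows `i` and `w i` agree, so the rows are constant along cycles and
descend to the quotient. -/
theorem mem_range_repeatRows_iff (w : Equiv.Perm (Fin n)) (A : Fin n × Fin n →₀ ℕ) :
    A ∈ Set.range (repeatRows w) ↔ A.mapDomain (Prod.map w id) = A := by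
  rw [mapDomain_permuteRows_eq_self_iff]
  constructor
  · rintro ⟨B, rfl⟩ i j
    have h : (Quotient.mk _ (w i) : Cycles w) = Quotient.mk _ i :=
      Quotient.sound (Equiv.Perm.sameCycle_apply_left.mpr (Equiv.Perm.SameCycle.refl _ _))
    rw [repeatRows_apply, repeatRows_apply, h]
  · intro hA
    have hpow : ∀ (k : ℕ) i j, A ((w ^ k) i, j) = A (i, j) := by
      intro k
      induction k with
      | zero => exact fun _ _ => rfl
      | succ k ih => exact fun i j => by rw [pow_succ', Equiv.Perm.mul_apply, hA, ih]
    refine ⟨Quotient.lift (fun i => Finsupp.equivFunOnFinite.symm fun j => A (i, j)) ?_, ?_⟩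
    · intro i i' h
      have h : w.SameCycle i i' := h
      -- `SameCycle` provides an integer power; finiteness replaces it by a natural one, for which
      -- `hpow` applies.
      obtain ⟨k, rfl⟩ := h.exists_nat_pow_eq
      ext j
      simp only [Finsupp.equivFunOnFinite_symm_apply_apply, hpow]
    · ext ⟨i, j⟩
      rw [repeatRows_apply, Quotient.lift_mk, Finsupp.equivFunOnFinite_symm_apply_apply]

/-- A `w`-invariant matrix is given by one row for each cycle of `w`. -/
theorem card_invariantMatrices (w : Equiv.Perm (Fin n)) (y : Fin n →₀ ℕ) :
    Nat.card (InvariantMatrices w y) =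
      Nat.card {B : Cycles w → Fin n →₀ ℕ // ∑ c, cycleLength w c • B c = y} := by
  have hmem : ∀ B : {B : Cycles w → Fin n →₀ ℕ // ∑ c, cycleLength w c • B c = y},
      (repeatRows w B.1).mapDomain (Prod.map w id) = repeatRows w B.1 ∧
        (repeatRows w B.1).mapDomain Prod.snd = y := fun B =>
    ⟨(mem_range_repeatRows_iff w _).mp ⟨B.1, rfl⟩, (mapDomain_snd_repeatRows w _).trans B.2⟩
  let F : {B : Cycles w → Fin n →₀ ℕ // ∑ c, cycleLength w c • B c = y} →
      InvariantMatrices w y := fun B => ⟨repeatRows w B.1, hmem B⟩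
  refine (Nat.card_eq_of_bijective F ⟨?_, ?_⟩).symm
  · exact fun B B' h => Subtype.ext (repeatRows_injective w (congrArg Subtype.val h))
  · rintro ⟨A, hA, hy⟩
    obtain ⟨B, rfl⟩ := (mem_range_repeatRows_iff w A).mpr hA
    exact ⟨⟨B, (mapDomain_snd_repeatRows w B).symm.trans hy⟩, rfl⟩

/-- As an algebra homomorphism, plethysm with `H` turns `p_{λ(w)}` into a product over the cycles of
`w`, so the coefficient takes the same form as in `coeff_chFamily_Ind`. -/
theorem coeff_plethysm_frobeniusChar {V : Type*} [AddCommGroup V] [Module ℂ V]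
    (ρ : Representation ℂ (Equiv.Perm (Fin n)) V) (y : Fin n →₀ ℕ) :
    MvPowerSeries.coeff y (plethysm (frobeniusChar ρ) (H n)) =
      (n.factorial : ℂ)⁻¹ * ∑ w : Equiv.Perm (Fin n), LinearMap.trace ℂ V (ρ w) *
        (Nat.card (InvariantMatrices w y) : ℂ) := by
  have hw : ∀ w : Equiv.Perm (Fin n), plethysmHom (H n) (w.partition.parts.map psum).prod =
      ∏ c, powSeries n (cycleLength w c) := fun w => by
    rw [← map_cycleLength, Multiset.map_map]
    change plethysmHom (H n) (∏ c, psum (cycleLength w c)) = _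
    rw [map_prod]
    exact Finset.prod_congr rfl fun c _ => plethysm_psum (cycleLength_ne_zero w c)
  rw [← plethysmHom_apply, frobeniusChar, map_smul, map_sum, MvPowerSeries.coeff_smul, map_sum]
  congr 1
  refine Finset.sum_congr rfl fun w _ => ?_
  rw [map_smul, hw, MvPowerSeries.coeff_smul, coeff_prod_powSeries _ (cycleLength_ne_zero w),
    card_invariantMatrices]

end Counting

end PolyInd

end

theorem theorem4p5 {n : ℕ} {V : Type*} [AddCommGroup V] [Module ℂ V] [FiniteDimensional ℂ V]
    (ρ : Representation ℂ (Equiv.Perm (Fin n)) V) :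
    PolyInd.chFamily (fun d => PolyInd.Ind d ρ) =
      PolyInd.plethysm (PolyInd.frobeniusChar ρ) (PolyInd.H n) := by
  ext x
  rw [PolyInd.coeff_chFamily_Ind, PolyInd.coeff_plethysm_frobeniusChar]
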